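/- Let $V$ be a finite-dimensional vector space over an arbitrary field $\mathbb F$, let $n=\dim V$, and let $GL(V)$ act on $\mathbb F[V]=\mathrm{Sym}(V^*)$ by the algebra automorphisms with $g\cdot\varphi=\varphi\circ g^{-1}$ for $\varphi\in V^*$. For a subgroup $G\le GL(V)$, call homogeneous, algebraically independent polynomials $f_1,\dots,f_n\in\mathbb F[V]$ *basic invariants* for $G$ if $\mathbb F[V]^G=\mathbb F[f_1,\dots,f_n]$. A *transvection about* a hyperplane $H$ (a linear subspace of codimension one) is a non-identity element of $GL(V)$ of finite order and determinant $1$ that fixes $H$ pointwise. Let $G\le GL(V)$ be a finite group that fixes a hyperplane $H$ of $V$ pointwise, let $t\notin G$ be a transvection about $H$, and let $G'=\langle G,t\rangle$. Then there exist basic invariants $f_1,\dots,f_n$ for $G$ and an invariant $f_1'$ of $G'$ such that $f_1',f_2,\dots,f_n$ are basic invariants for $G'$. In particular, $f_2,\dots,f_n$ are invariant under $G'$, so all basic invariants for $G$ except one can be chosen to be $G'$-invariant. -/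

import Mathlib

namespace LinInv

open Module

variable {F V : Type*} [Field F] [AddCommGroup V] [Module F V]

/-- The ring `F[V] = Sym(V*)` of polynomials on `V`. -/
abbrev PolyRing (F V : Type*) [Field F] [AddCommGroup V] [Module F V] : Type _ :=
  SymmetricAlgebra F (Dual F V)

/-- The natural action of `g ∈ GL(V)` on `F[V]`: the algebra endomorphism that sends a linear
form `φ ∈ V*` to `φ ∘ g⁻¹`. -/
noncomputable def act (g : V ≃ₗ[F] V) : PolyRing F V →ₐ[F] PolyRing F V :=
  SymmetricAlgebra.lift
    (SymmetricAlgebra.ι F (Dual F V) ∘ₗ (g.symm : V →ₗ[F] V).dualMap)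

theorem act_ι (g : V ≃ₗ[F] V) (φ : Dual F V) :
    act g (SymmetricAlgebra.ι F (Dual F V) φ) =
      SymmetricAlgebra.ι F (Dual F V) (φ ∘ₗ (g.symm : V →ₗ[F] V)) := by
  simp [act, LinearMap.dualMap_apply']

/-- The ring of invariants `F[V]^G`. -/
noncomputable def invariants (G : Subgroup (V ≃ₗ[F] V)) : Subalgebra F (PolyRing F V) where
  carrier := {f | ∀ g ∈ G, act g f = f}
  mul_mem' ha hb g hg := by rw [map_mul, ha g hg, hb g hg]
  add_mem' ha hb g hg := by rw [map_add, ha g hg, hb g hg]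
  algebraMap_mem' r g _ := (act g).commutes r

theorem mem_invariants {G : Subgroup (V ≃ₗ[F] V)} {f : PolyRing F V} :
    f ∈ invariants G ↔ ∀ g ∈ G, act g f = f := Iff.rfl

/-- The homogeneous component `Sym^d(V*)` of `F[V]`: the span of the products of `d` linear
forms. -/
noncomputable def homogeneousPart (F V : Type*) [Field F] [AddCommGroup V] [Module F V] (d : ℕ) :
    Submodule F (PolyRing F V) :=
  (LinearMap.range (SymmetricAlgebra.ι F (Dual F V))) ^ d

/-- `f` is homogeneous (of some degree). -/
def IsHomogeneousPoly (f : PolyRing F V) : Prop := ∃ d : ℕ, f ∈ homogeneousPart F V d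

/-- `f₁, …, fₙ`, with `n = dim V`, are basic invariants for `G`: they are homogeneous and
algebraically independent, and `F[V]^G = F[f₁, …, fₙ]`. -/
structure IsBasicInvariants (G : Subgroup (V ≃ₗ[F] V)) (f : Fin (finrank F V) → PolyRing F V) :
    Prop where
  homogeneous : ∀ i, IsHomogeneousPoly (f i)
  algebraicIndependent : AlgebraicIndependent F f
  invariants_eq : invariants G = Algebra.adjoin F (Set.range f)

/-- `t` is a reflection about the hyperplane `H`: an element of finite order of `GL(V)` that
fixes `H` pointwise (the identity is not excluded). -/
structure IsReflectionAbout (H : Submodule F V) (t : V ≃ₗ[F] V) : Prop where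
  isOfFinOrder : IsOfFinOrder t
  fixes : ∀ v ∈ H, t v = v

/-- `t` is a transvection about the hyperplane `H`: a reflection about `H` of determinant `1` that
is not diagonalizable. Since all eigenvalues of a reflection of determinant `1` equal `1`, the
last condition says that `t` is not the identity. -/
structure IsTransvectionAbout (H : Submodule F V) (t : V ≃ₗ[F] V) : Prop
    extends IsReflectionAbout H t where
  det_eq_one : LinearMap.det (t : V →ₗ[F] V) = 1
  ne_one : t ≠ 1

end LinInv

/-! Write `H = ker ℓ`. Elements of `G` act on polynomials by shears `v ↦ v + ℓ v • b`. Those with `ℓ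
b = 0` form a finite additive group `A` of vectors; together with one reflection `g₀`, having an
eigenvector `v₀` off `H` and an eigenvalue `ζ` that generates all determinants, they generate `G`.
Conjugation by `g₀` multiplies `A` by `ζ`. Since `t` forces positive characteristic, `A` is a vector
space over a finite field `K` containing `ζ`, say with `q` elements.

Invariants are built by enlarging a `K`-space of vectors one generator at a time (`IsAdapted`). The
family consists of `ℓ` and forms `f j` that a shear along `v ∈ H` translates by `lam j v • ℓ ^ q ^ m
j`; the common kernel of the `lam j` on `H` is the space treated so far. For a new vector `a`, a
triangular change makes a single `f i₁` detect it (`exists_normalized`). Replacing `f i₁` by the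
product of its translates by the `K`-multiples of `lam i₁ a • ℓ ^ q ^ m i₁` then adjoins `a` to the
space (`extend`). Finally `ℓ` is replaced by its power of exponent the order of `ζ`, which accounts
for `g₀`.

Apply this to `A`, normalize with respect to the vector `a` of `t`, and read off basic invariants of
`G`. One more extension treats `A + K a`, hence `G'`, and changes only the member `i₁`. -/

namespace LinInv

open Module

/-! ### Polynomials in one generator over the algebra of the others -/

section Algebra

open Polynomial

/-- A polynomial over a domain that is invariant under at least `deg Q` translations, all of which
fix the monic polynomial `Q`, is a polynomial in `Q`. -/
theorem mem_adjoin_of_comp_X_add_C {S : Type*} [CommRing S] [IsDomain S] {Q : S[X]}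
    (hQ : Q.Monic) (hQ0 : Q.natDegree ≠ 0) (D : Finset S) (hD : Q.natDegree ≤ D.card)
    (hinv : ∀ d ∈ D, Q.comp (X + C d) = Q) (P : S[X]) (hP : ∀ d ∈ D, P.comp (X + C d) = P) :
    P ∈ Algebra.adjoin S {Q} := by
  induction hn : P.natDegree using Nat.strong_induction_on generalizing P with
  | _ n ih =>
    have key : ∀ d ∈ D, (P /ₘ Q).comp (X + C d) = P /ₘ Q ∧ (P %ₘ Q).comp (X + C d) = P %ₘ Q := by
      intro d hd
      have h1 : (P %ₘ Q).comp (X + C d) + Q * (P /ₘ Q).comp (X + C d) = P := by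
        conv_lhs => rw [← hinv d hd]
        rw [hinv d hd]
        have := congrArg (fun R : S[X] => R.comp (X + C d)) (modByMonic_add_div P Q)
        simp only [add_comp, mul_comp, hinv d hd, hP d hd] at this
        exact this
      have h2 : ((P %ₘ Q).comp (X + C d)).degree < Q.degree := by
        rw [← taylor_apply, degree_taylor]
        exact degree_modByMonic_lt P hQ
      have := div_modByMonic_unique _ _ hQ ⟨h1, h2⟩
      exact ⟨this.1.symm, this.2.symm⟩
    -- The remainder `r` is itself invariant, so `r(d) = r(0)` for at least `deg Q > deg r` values
    -- `d`, and `r` is constant.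
    have hr : P %ₘ Q = C ((P %ₘ Q).eval 0) := by
      refine eq_of_degree_sub_lt_of_eval_finset_eq D ?_ ?_
      · refine lt_of_le_of_lt (degree_sub_le _ _) (max_lt ?_ ?_)
        · refine (degree_modByMonic_lt P hQ).trans_le ?_
          rw [degree_eq_natDegree hQ.ne_zero]
          exact_mod_cast hD
        · refine lt_of_le_of_lt degree_C_le ?_
          exact_mod_cast lt_of_lt_of_le (Nat.pos_of_ne_zero hQ0) hD
      · intro d hd
        have := congrArg (fun R : S[X] => R.eval 0) (key d hd).2
        simpa [eval_comp] using this
    have hQmem : Q ∈ Algebra.adjoin S {Q} := Algebra.subset_adjoin rfl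
    have hdiv : P /ₘ Q ∈ Algebra.adjoin S {Q} := by
      by_cases h0 : P.natDegree = 0
      · have : P /ₘ Q = 0 := by
          rw [divByMonic_eq_zero_iff hQ]
          exact degree_lt_degree (by omega)
        rw [this]
        exact zero_mem _
      · refine ih _ ?_ (P /ₘ Q) (fun d hd => (key d hd).1) rfl
        rw [natDegree_divByMonic _ hQ]
        omega
    rw [← modByMonic_add_div P Q, hr]
    exact add_mem (Subalgebra.algebraMap_mem _ _) (mul_mem hQmem hdiv)

/-- A polynomial over a domain that is invariant under `X ↦ ζ X` is a polynomial in `X ^ e`, where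
`e` is the order of `ζ`. -/
theorem mem_adjoin_of_comp_C_mul_X {S : Type*} [CommRing S] [IsDomain S] {ζ : S} {e : ℕ}
    (he : ∀ n : ℕ, ζ ^ n = 1 → e ∣ n) (P : S[X]) (hP : P.comp (C ζ * X) = P) :
    P ∈ Algebra.adjoin S {(X ^ e : S[X])} := by
  have hmem : ∀ n ∈ P.support, C (P.coeff n) * X ^ n ∈ Algebra.adjoin S {(X ^ e : S[X])} := by
    intro n hn
    have h1 : P.coeff n * ζ ^ n = P.coeff n := by
      rw [← comp_C_mul_X_coeff, hP]
    have h2 : ζ ^ n = 1 := mul_left_cancel₀ (mem_support_iff.1 hn) (by rw [h1, mul_one])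
    obtain ⟨k, hk⟩ := he n h2
    rw [hk, pow_mul]
    exact mul_mem (Subalgebra.algebraMap_mem _ _) (pow_mem (Algebra.subset_adjoin (Set.mem_singleton _)) _)
  have h := sum_mem hmem
  rwa [← as_sum_support_C_mul_X_pow P] at h

variable {F R ι : Type*} [Field F] [CommRing R] [Algebra F R]

/-- The subalgebra generated by all members of a family but one. -/
abbrev adjoinOthers (F : Type*) {R ι : Type*} [Field F] [CommRing R] [Algebra F R]
    (f : ι → R) (i : ι) : Subalgebra F R :=
  Algebra.adjoin F (f '' {i}ᶜ)

theorem mem_adjoinOthers {f : ι → R} {i j : ι} (h : j ≠ i) : f j ∈ adjoinOthers F f i :=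
  Algebra.subset_adjoin ⟨j, h, rfl⟩

/-- This allows `F[f]` to be treated as a polynomial ring in the single variable `f i` over
`adjoinOthers F f i`. -/
theorem algebraicIndependent_iff_others {f : ι → R} (i : ι) :
    AlgebraicIndependent F f ↔
      AlgebraicIndepOn F f {i}ᶜ ∧ Transcendental (adjoinOthers F f i) (f i) := by
  rw [← AlgebraicIndepOn.insert_iff (by simp), show insert i ({i}ᶜ : Set ι) = Set.univ by ext; simp [em]]
  exact (algebraicIndependent_equiv (Equiv.Set.univ ι)).symm

theorem exists_aeval_eq_of_mem_adjoin {f : ι → R} (i : ι) {p : R}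
    (hp : p ∈ Algebra.adjoin F (Set.range f)) :
    ∃ P : (adjoinOthers F f i)[X], aeval (f i) P = p := by
  have : Algebra.adjoin F (Set.range f) ≤
      (aeval (R := adjoinOthers F f i) (f i)).range.restrictScalars F := by
    refine Algebra.adjoin_le ?_
    rintro _ ⟨j, rfl⟩
    by_cases h : j = i
    · subst h
      exact ⟨X, aeval_X _⟩
    · exact ⟨C ⟨f j, mem_adjoinOthers h⟩, aeval_C _ _⟩
  exact this hp

theorem algHom_apply_of_mem_adjoinOthers {f : ι → R} {i : ι} {τ : R →ₐ[F] R}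
    (hτ : ∀ j, j ≠ i → τ (f j) = f j) {s : R} (hs : s ∈ adjoinOthers F f i) : τ s = s := by
  have : adjoinOthers F f i ≤ AlgHom.equalizer τ (AlgHom.id F R) := by
    refine Algebra.adjoin_le ?_
    rintro _ ⟨j, hj, rfl⟩
    exact hτ j hj
  exact this hs

theorem algHom_aeval {f : ι → R} {i : ι} {τ : R →ₐ[F] R} (hτ : ∀ j, j ≠ i → τ (f j) = f j)
    {W : (adjoinOthers F f i)[X]} (hW : τ (f i) = aeval (f i) W) (P : (adjoinOthers F f i)[X]) :
    τ (aeval (f i) P) = aeval (f i) (P.comp W) := by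
  rw [aeval_comp, ← hW]
  induction P using Polynomial.induction_on' with
  | add p q hp hq => simp only [map_add, hp, hq]
  | monomial n a =>
    simp only [aeval_monomial, map_mul, map_pow]
    congr 1
    exact algHom_apply_of_mem_adjoinOthers hτ a.2

/-- Transcendence of `f i` over the other members turns invariance under `τ` into invariance of a
one-variable polynomial under a substitution, where the two lemmas on translations and scalings
apply. -/
theorem comp_eq_self_of_algHom_eq {f : ι → R} (hf : AlgebraicIndependent F f) {i : ι}
    {τ : R →ₐ[F] R} (hτ : ∀ j, j ≠ i → τ (f j) = f j)
    {W : (adjoinOthers F f i)[X]} (hW : τ (f i) = aeval (f i) W) {P : (adjoinOthers F f i)[X]}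
    (hP : τ (aeval (f i) P) = aeval (f i) P) : P.comp W = P := by
  have := transcendental_iff_injective.1 ((algebraicIndependent_iff_others i).1 hf).2
  exact this (by rw [← algHom_aeval hτ hW, hP])

theorem image_update_compl {R ι : Type*} [DecidableEq ι] (f : ι → R) (i : ι) (x : R) :
    Function.update f i x '' {i}ᶜ = f '' {i}ᶜ :=
  Set.image_congr fun _ hj => Function.update_of_ne hj _ _

theorem algebraicIndependent_update_aeval [DecidableEq ι] {f : ι → R} (hf : AlgebraicIndependent F f) {i : ι}
    {Q : (adjoinOthers F f i)[X]} (hQ : Q.Monic) (hQ0 : Q.natDegree ≠ 0) :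
    AlgebraicIndependent F (Function.update f i (aeval (f i) Q)) := by
  obtain ⟨h1, h2⟩ := (algebraicIndependent_iff_others i).1 hf
  rw [algebraicIndependent_iff_others i]
  refine ⟨?_, ?_⟩
  · have : (fun j : ({i}ᶜ : Set ι) => Function.update f i (aeval (f i) Q) j) =
        fun j : ({i}ᶜ : Set ι) => f j := by
      funext j
      exact Function.update_of_ne j.2 _ _
    unfold AlgebraicIndepOn at h1 ⊢
    rw [this]
    exact h1
  · unfold adjoinOthers
    rw [image_update_compl, Function.update_self]
    exact h2.aeval Q hQ0 (by rw [hQ.leadingCoeff]; exact one_mem _)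

theorem aeval_mem_adjoin_update [DecidableEq ι] {f : ι → R} {i : ι} {Q P : (adjoinOthers F f i)[X]}
    (hP : P ∈ Algebra.adjoin (adjoinOthers F f i) {Q}) :
    aeval (f i) P ∈ Algebra.adjoin F (Set.range (Function.update f i (aeval (f i) Q))) := by
  have hle : adjoinOthers F f i ≤
      Algebra.adjoin F (Set.range (Function.update f i (aeval (f i) Q))) := by
    refine Algebra.adjoin_mono ?_
    conv_lhs => rw [← image_update_compl f i (aeval (f i) Q)]
    exact Set.image_subset_range _ _
  induction hP using Algebra.adjoin_induction with
  | mem x hx =>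
    rw [Set.mem_singleton_iff.1 hx]
    exact Algebra.subset_adjoin ⟨i, Function.update_self _ _ _⟩
  | algebraMap r =>
    rw [← C_eq_algebraMap, aeval_C]
    exact hle r.2
  | add x y _ _ hx hy => rw [map_add]; exact add_mem hx hy
  | mul x y _ _ hx hy => rw [map_mul]; exact mul_mem hx hy

theorem adjoin_range_triangular {f g : ι → R} {s : Set ι} (hs : ∀ j ∈ s, g j = f j)
    (hg : ∀ j, g j - f j ∈ Algebra.adjoin F (f '' s)) :
    Algebra.adjoin F (Set.range g) = Algebra.adjoin F (Set.range f) := by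
  have him : g '' s = f '' s := Set.image_congr hs
  apply le_antisymm <;> refine Algebra.adjoin_le ?_ <;> rintro _ ⟨j, rfl⟩
  · have h1 := Algebra.adjoin_mono (R := F) (Set.image_subset_range f s) (hg j)
    have h2 : f j ∈ Algebra.adjoin F (Set.range f) := Algebra.subset_adjoin ⟨j, rfl⟩
    simpa using add_mem h1 h2
  · have h1 := Algebra.adjoin_mono (R := F) (Set.image_subset_range g s) (him ▸ hg j)
    have h2 : g j ∈ Algebra.adjoin F (Set.range g) := Algebra.subset_adjoin ⟨j, rfl⟩
    simpa using sub_mem h2 h1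

/-- The change from `f` to `g` lifts to a triangular automorphism of the polynomial ring. -/
theorem algebraicIndependent_triangular {f g : ι → R} {s : Set ι} (hf : AlgebraicIndependent F f)
    (hs : ∀ j ∈ s, g j = f j) (hg : ∀ j, g j - f j ∈ Algebra.adjoin F (f '' s)) :
    AlgebraicIndependent F g := by
  have hex : ∀ j, ∃ r ∈ Algebra.adjoin F (MvPolynomial.X '' s : Set (MvPolynomial ι F)),
      MvPolynomial.aeval f r = g j - f j := by
    intro j
    have h := hg j
    have : f '' s = MvPolynomial.aeval f '' (MvPolynomial.X '' s : Set (MvPolynomial ι F)) := by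
      rw [Set.image_image]
      simp
    rw [this, ← AlgHom.map_adjoin] at h
    exact h
  choose r hr hrf using hex
  have hr0 : ∀ j ∈ s, r j = 0 := by
    intro j hj
    apply hf
    rw [hrf, hs j hj, sub_self, map_zero]
  -- `Ψ` undoes `Φ` because it fixes every `r j`: these involve only variables from `s`, where the
  -- corrections vanish.
  let Ψ : MvPolynomial ι F →ₐ[F] MvPolynomial ι F :=
    MvPolynomial.aeval fun j => MvPolynomial.X j - r j
  let Φ : MvPolynomial ι F →ₐ[F] MvPolynomial ι F :=
    MvPolynomial.aeval fun j => MvPolynomial.X j + r j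
  have hΨ : ∀ p ∈ Algebra.adjoin F (MvPolynomial.X '' s : Set (MvPolynomial ι F)), Ψ p = p := by
    intro p hp
    have : Algebra.adjoin F (MvPolynomial.X '' s : Set (MvPolynomial ι F)) ≤
        AlgHom.equalizer Ψ (AlgHom.id F _) := by
      refine Algebra.adjoin_le ?_
      rintro _ ⟨j, hj, rfl⟩
      change Ψ (MvPolynomial.X j) = MvPolynomial.X j
      simp [Ψ, hr0 j hj]
    exact this hp
  have hΨΦ : Ψ.comp Φ = AlgHom.id F _ := by
    refine MvPolynomial.algHom_ext fun j => ?_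
    rw [AlgHom.comp_apply]
    simp only [Φ, MvPolynomial.aeval_X, map_add, hΨ _ (hr j)]
    simp [Ψ]
  have hcomp : (MvPolynomial.aeval f).comp Φ = MvPolynomial.aeval g := by
    refine MvPolynomial.algHom_ext fun j => ?_
    simp [Φ, hrf]
  unfold AlgebraicIndependent
  rw [← hcomp]
  have hΦ : Function.Injective Φ := Function.LeftInverse.injective (g := Ψ) fun p => by
    exact DFunLike.congr_fun hΨΦ p
  rw [AlgHom.coe_comp]
  exact Function.Injective.comp hf hΦ

end Algebra

/-! ### Shears on the polynomial ring -/

section Shear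

variable {F V : Type*} [Field F] [AddCommGroup V] [Module F V]

theorem algHom_ext_ι {σ τ : PolyRing F V →ₐ[F] PolyRing F V}
    (h : ∀ φ, σ (SymmetricAlgebra.ι F (Dual F V) φ) = τ (SymmetricAlgebra.ι F (Dual F V) φ)) :
    σ = τ :=
  SymmetricAlgebra.algHom_ext (LinearMap.ext h)

/-- The algebra endomorphism of `F[V]` induced by the linear map `v ↦ v + ℓ v • b`. -/
noncomputable def shear (ℓ : Dual F V) (b : V) : PolyRing F V →ₐ[F] PolyRing F V :=
  SymmetricAlgebra.lift (SymmetricAlgebra.ι F (Dual F V) +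
    (Dual.eval F V b).smulRight (SymmetricAlgebra.ι F (Dual F V) ℓ))

theorem shear_ι (ℓ : Dual F V) (b : V) (φ : Dual F V) :
    shear ℓ b (SymmetricAlgebra.ι F (Dual F V) φ) =
      SymmetricAlgebra.ι F (Dual F V) φ + φ b • SymmetricAlgebra.ι F (Dual F V) ℓ := by
  simp [shear]

theorem shear_ι_self (ℓ : Dual F V) (b : V) :
    shear ℓ b (SymmetricAlgebra.ι F (Dual F V) ℓ) =
      (1 + ℓ b) • SymmetricAlgebra.ι F (Dual F V) ℓ := by
  rw [shear_ι, add_smul, one_smul]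

theorem shear_shear (ℓ : Dual F V) (b c : V) (p : PolyRing F V) :
    shear ℓ b (shear ℓ c p) = shear ℓ (b + (1 + ℓ b) • c) p := by
  have : (shear ℓ b).comp (shear ℓ c) = shear ℓ (b + (1 + ℓ b) • c) := by
    refine algHom_ext_ι fun φ => ?_
    simp only [AlgHom.comp_apply, shear_ι, map_add,
      map_smul, smul_eq_mul]
    module
  exact DFunLike.congr_fun this p

theorem shear_zero (ℓ : Dual F V) (p : PolyRing F V) : shear ℓ 0 p = p := by
  have : shear ℓ (0 : V) = AlgHom.id F (PolyRing F V) := by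
    refine algHom_ext_ι fun φ => ?_
    simp [shear_ι]
  exact DFunLike.congr_fun this p

/-- The inverse appears because `act g` composes with `g⁻¹`; it is harmless for questions of
invariance under a group. -/
theorem act_inv_eq_shear {ℓ : Dual F V} {b : V} {g : V ≃ₗ[F] V} (hg : ∀ v, g v = v + ℓ v • b) :
    act g⁻¹ = shear ℓ b := by
  refine algHom_ext_ι fun φ => ?_
  simp only [act_ι, shear_ι]
  rw [← map_smul, ← map_add]
  congr 1
  ext v
  change φ (g v) = _
  simp [hg, mul_comm]

theorem ι_pow_mem_homogeneousPart (φ : Dual F V) (d : ℕ) :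
    SymmetricAlgebra.ι F (Dual F V) φ ^ d ∈ homogeneousPart F V d :=
  Submodule.pow_mem_pow _ (LinearMap.mem_range_self _ φ) d

theorem pow_mem_homogeneousPart {p : PolyRing F V} {d : ℕ} (hp : p ∈ homogeneousPart F V d)
    (k : ℕ) : p ^ k ∈ homogeneousPart F V (d * k) := by
  unfold homogeneousPart
  rw [pow_mul]
  exact Submodule.pow_mem_pow _ hp k

theorem mul_mem_homogeneousPart {p r : PolyRing F V} {d e : ℕ} (hp : p ∈ homogeneousPart F V d)
    (hr : r ∈ homogeneousPart F V e) : p * r ∈ homogeneousPart F V (d + e) := by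
  unfold homogeneousPart
  rw [pow_add]
  exact Submodule.mul_mem_mul hp hr

end Shear

/-! ### Adapted families and their normalization -/

section Adapted

variable {F V K ι : Type*} [Field F] [AddCommGroup V] [Module F V] [Field K] [Fintype K]
  [Algebra K F] [Module K V]

theorem add_pow_card_of_algebra (F : Type*) {K R : Type*} [Field F] [Field K] [Fintype K]
    [Algebra K F] [CommRing R] [Algebra F R] (x y : R) :
    (x + y) ^ Fintype.card K = x ^ Fintype.card K + y ^ Fintype.card K := by
  let _ : Algebra K R := Algebra.compHom R (algebraMap K F)
  exact map_add (FiniteField.frobeniusAlgHom K R) x y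

theorem algebraMap_pow_card (F : Type*) {K : Type*} [Field F] [Field K] [Fintype K]
    [Algebra K F] (c : K) : algebraMap K F c ^ Fintype.card K = algebraMap K F c := by
  rw [← map_pow, FiniteField.pow_card]

theorem exists_algebraMap_eq_of_pow_card_eq {F K : Type*} [Field F] [Field K] [Fintype K]
    [Algebra K F] {x : F} (hx : x ^ Fintype.card K = x) : ∃ c : K, algebraMap K F c = x := by
  classical
  open Polynomial in
  have hne : (X ^ Fintype.card K - X : F[X]) ≠ 0 :=
    FiniteField.X_pow_card_sub_X_ne_zero F Fintype.one_lt_card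
  by_contra! hcon
  -- Otherwise `x` and the image of `K` would be `q + 1` roots of `X ^ q - X`.
  have hsub : insert x (Finset.univ.image (algebraMap K F)) ⊆
      (Polynomial.X ^ Fintype.card K - Polynomial.X : Polynomial F).roots.toFinset := by
    intro z hz
    rw [Multiset.mem_toFinset, Polynomial.mem_roots hne]
    rcases Finset.mem_insert.1 hz with rfl | hz
    · simp [Polynomial.IsRoot, hx]
    · obtain ⟨c, -, rfl⟩ := Finset.mem_image.1 hz
      simp [Polynomial.IsRoot, algebraMap_pow_card]
  have h1 := Finset.card_le_card hsub
  rw [Finset.card_insert_of_notMem (by simpa using hcon),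
    Finset.card_image_of_injective _ (algebraMap K F).injective, Finset.card_univ] at h1
  have h2 := (Multiset.toFinset_card_le _).trans (Polynomial.card_roots'
    (Polynomial.X ^ Fintype.card K - Polynomial.X : Polynomial F))
  rw [FiniteField.X_pow_card_sub_X_natDegree_eq F Fintype.one_lt_card] at h2
  omega

variable (K) in
/-- A homogeneous, algebraically independent family `f` that contains the linear form `ℓ`, such that
the transvections `v ↦ v + ℓ v • b` act on the other members by translation by multiples of powers
of `ℓ`, the dilatations `v₀ ↦ c v₀` for `c ∈ Kˣ` fix these members, and `f` generates the invariants
of those transvections that fix all its members. -/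
structure IsAdapted (ℓ : Dual F V) (v₀ : V) (i₀ : ι) (f : ι → PolyRing F V) (m : ι → ℕ)
    (lam : ι → V →ₗ[K] F) : Prop where
  eq_ι : f i₀ = SymmetricAlgebra.ι F (Dual F V) ℓ
  homogeneous : ∀ j, j ≠ i₀ → f j ∈ homogeneousPart F V (Fintype.card K ^ m j)
  translate : ∀ j, j ≠ i₀ → ∀ v, ℓ v = 0 →
    shear ℓ v (f j) = f j + lam j v • f i₀ ^ Fintype.card K ^ m j
  scale : ∀ j, j ≠ i₀ → ∀ c : K, c ≠ 0 → shear ℓ ((algebraMap K F c - 1) • v₀) (f j) = f j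
  algebraicIndependent : AlgebraicIndependent F f
  mem_adjoin : ∀ p, (∀ v, ℓ v = 0 → (∀ j, j ≠ i₀ → lam j v = 0) → shear ℓ v p = p) →
    p ∈ Algebra.adjoin F (Set.range f)

theorem IsAdapted.shear_base {ℓ : Dual F V} {v₀ : V} {i₀ : ι} {f : ι → PolyRing F V} {m : ι → ℕ}
    {lam : ι → V →ₗ[K] F} (h : IsAdapted K ℓ v₀ i₀ f m lam) {v : V} (hv : ℓ v = 0) :
    shear ℓ v (f i₀) = f i₀ := by
  rw [h.eq_ι, shear_ι_self, hv, add_zero, one_smul]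

theorem IsAdapted.scale_base {ℓ : Dual F V} {v₀ : V} {i₀ : ι} {f : ι → PolyRing F V} {m : ι → ℕ}
    {lam : ι → V →ₗ[K] F} (h : IsAdapted K ℓ v₀ i₀ f m lam) (hv₀ : ℓ v₀ = 1) (c : K) :
    shear ℓ ((algebraMap K F c - 1) • v₀) (f i₀) = algebraMap K F c • f i₀ := by
  rw [h.eq_ι, shear_ι_self, map_smul, hv₀, smul_eq_mul, mul_one, add_sub_cancel]

/-- Starting point of the construction: linear coordinates, for which the treated space is zero. -/
theorem IsAdapted.of_basis [IsScalarTower K F V] {ℓ : Dual F V} {v₀ : V} {i₀ : ι} (b : Basis ι F (Dual F V))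
    (hℓ : b i₀ = ℓ) (hb : ∀ j, j ≠ i₀ → b j v₀ = 0) :
    IsAdapted K ℓ v₀ i₀ (fun j => SymmetricAlgebra.ι F (Dual F V) (b j)) (fun _ => 0)
      (fun j => (b j).restrictScalars K) where
  eq_ι := by rw [hℓ]
  homogeneous j _ := by simpa using ι_pow_mem_homogeneousPart (b j) 1
  translate j _ v _ := by simp [shear_ι, hℓ]
  scale j hj c _ := by simp [shear_ι, hb j hj]
  algebraicIndependent := by
    have : (fun j => SymmetricAlgebra.ι F (Dual F V) (b j)) =
        (SymmetricAlgebra.equivMvPolynomial b).symm ∘ MvPolynomial.X := by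
      funext j
      simp
    rw [this]
    exact (MvPolynomial.algebraicIndependent_X ι F).map'
      (f := (SymmetricAlgebra.equivMvPolynomial b).symm.toAlgHom)
      (SymmetricAlgebra.equivMvPolynomial b).symm.injective
  mem_adjoin p _ := by
    have : (MvPolynomial.aeval fun j => SymmetricAlgebra.ι F (Dual F V) (b j)) =
        (SymmetricAlgebra.equivMvPolynomial b).symm.toAlgHom :=
      MvPolynomial.algHom_ext fun j => by simp
    rw [Algebra.adjoin_range_eq_range_aeval, this]
    exact ⟨SymmetricAlgebra.equivMvPolynomial b p, by simp⟩

/-- The power of `ℓ` raises the degree of `f i₁` to that of `f j`, which requires `m i₁ ≤ m j`.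
Dilatations by `Kˣ` still fix the new members, because the exponent of `ℓ` is a difference of powers
of `q`. -/
theorem IsAdapted.triangular {ℓ : Dual F V} {v₀ : V} {i₀ i₁ : ι} {f : ι → PolyRing F V} {m : ι → ℕ}
    {lam : ι → V →ₗ[K] F} (h : IsAdapted K ℓ v₀ i₀ f m lam) (hv₀ : ℓ v₀ = 1) (hi : i₁ ≠ i₀)
    (μ : ι → F) (hμ₀ : μ i₀ = 0) (hμ₁ : μ i₁ = 0) (hμ : ∀ j, μ j ≠ 0 → m i₁ ≤ m j) :
    IsAdapted K ℓ v₀ i₀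
      (fun j => f j - μ j • (f i₁ * f i₀ ^ (Fintype.card K ^ m j - Fintype.card K ^ m i₁))) m
      (fun j => lam j - LinearMap.mulLeft K (μ j) ∘ₗ lam i₁) := by
  set q := Fintype.card K with hq
  have hqpos : 0 < q := Fintype.card_pos
  have hle : ∀ j, μ j ≠ 0 → q ^ m i₁ + (q ^ m j - q ^ m i₁) = q ^ m j := fun j hj =>
    Nat.add_sub_cancel' (Nat.pow_le_pow_right hqpos (hμ j hj))
  have h0 : f i₀ - μ i₀ • (f i₁ * f i₀ ^ (q ^ m i₀ - q ^ m i₁)) = f i₀ := by simp [hμ₀]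
  have hs : ∀ j ∈ ({i₀, i₁} : Set ι),
      f j - μ j • (f i₁ * f i₀ ^ (q ^ m j - q ^ m i₁)) = f j := by
    rintro j (rfl | rfl) <;> simp [hμ₀, hμ₁]
  have hg : ∀ j, f j - μ j • (f i₁ * f i₀ ^ (q ^ m j - q ^ m i₁)) - f j ∈
      Algebra.adjoin F (f '' {i₀, i₁}) := by
    intro j
    rw [sub_sub_cancel_left]
    refine neg_mem (Subalgebra.smul_mem _ (mul_mem ?_ (pow_mem ?_ _)) _)
    · exact Algebra.subset_adjoin ⟨i₁, by simp, rfl⟩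
    · exact Algebra.subset_adjoin ⟨i₀, by simp, rfl⟩
  have hlam : ∀ v, (∀ j, j ≠ i₀ → lam j v = 0) →
      ∀ j, j ≠ i₀ → (lam j - LinearMap.mulLeft K (μ j) ∘ₗ lam i₁) v = 0 := by
    intro v hv j hj
    simp [hv j hj, hv i₁ hi]
  have hlam' : ∀ v, (∀ j, j ≠ i₀ → (lam j - LinearMap.mulLeft K (μ j) ∘ₗ lam i₁) v = 0) →
      ∀ j, j ≠ i₀ → lam j v = 0 := by
    intro v hv j hj
    have h1 : lam i₁ v = 0 := by simpa [hμ₁] using hv i₁ hi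
    simpa [h1] using hv j hj
  constructor
  · rw [h0, h.eq_ι]
  · intro j hj
    refine sub_mem (h.homogeneous j hj) ?_
    by_cases hμj : μ j = 0
    · simp [hμj]
    refine Submodule.smul_mem _ _ ?_
    rw [← hle j hμj, h.eq_ι]
    have := mul_mem_homogeneousPart (h.homogeneous i₁ hi)
      (ι_pow_mem_homogeneousPart ℓ (q ^ m j - q ^ m i₁))
    simpa using this
  · intro j hj v hv
    simp only [map_sub, map_smul, map_mul, map_pow, h.translate j hj v hv, h.translate i₁ hi v hv,
      h.shear_base hv, hμ₀, zero_smul, sub_zero, LinearMap.sub_apply, LinearMap.comp_apply,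
      LinearMap.mulLeft_apply]
    by_cases hμj : μ j = 0
    · simp [hμj]
    rw [← hq, add_mul, smul_mul_assoc, ← pow_add, hle j hμj]
    module
  · intro j hj c hc
    simp only [map_sub, map_smul, map_mul, map_pow, h.scale j hj c hc, h.scale i₁ hi c hc,
      h.scale_base hv₀]
    by_cases hμj : μ j = 0
    · simp [hμj]
    -- Every `c ∈ K` satisfies `c ^ q ^ k = c`, so both powers of `q` act alike as exponents and `c`
    -- can be cancelled.
    have hc' : algebraMap K F c ^ (q ^ m j - q ^ m i₁) = 1 := by
      have hpow : ∀ k : ℕ, c ^ q ^ k = c := fun k => FiniteField.pow_card_pow k c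
      have : c * c ^ (q ^ m j - q ^ m i₁) = c * 1 := by
        conv_lhs => rw [← hpow (m i₁)]
        rw [hpow (m i₁)]
        nth_rewrite 1 [← hpow (m i₁)]
        rw [← pow_add, hle j hμj, hpow, mul_one]
      rw [← map_pow, mul_left_cancel₀ hc this, map_one]
    rw [smul_pow, hc', one_smul]
  · exact algebraicIndependent_triangular h.algebraicIndependent hs hg
  · intro p hp
    rw [adjoin_range_triangular hs hg]
    exact h.mem_adjoin p fun v hv hv' => hp v hv (hlam v hv')

/-- Gaussian elimination at `a`, with pivot a member of least degree among those that detect `a`, so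
that the powers of `ℓ` needed have nonnegative exponents. -/
theorem IsAdapted.exists_normalized [Fintype ι] {ℓ : Dual F V} {v₀ : V} {i₀ : ι}
    {f : ι → PolyRing F V} {m : ι → ℕ} {lam : ι → V →ₗ[K] F} (h : IsAdapted K ℓ v₀ i₀ f m lam)
    (hv₀ : ℓ v₀ = 1) {a : V} (ha : ∃ j, j ≠ i₀ ∧ lam j a ≠ 0) :
    ∃ (i₁ : ι) (f' : ι → PolyRing F V) (lam' : ι → V →ₗ[K] F), i₁ ≠ i₀ ∧
      IsAdapted K ℓ v₀ i₀ f' m lam' ∧ (∀ j, j ≠ i₀ → j ≠ i₁ → lam' j a = 0) ∧ lam' i₁ a ≠ 0 ∧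
      ∀ v, (∀ j, j ≠ i₀ → lam' j v = 0) ↔ ∀ j, j ≠ i₀ → lam j v = 0 := by
  classical
  obtain ⟨i₁, hi₁, hmin⟩ := Finset.exists_min_image
    (Finset.univ.filter fun j => j ≠ i₀ ∧ lam j a ≠ 0) m
    (by obtain ⟨j, hj⟩ := ha; exact ⟨j, by simpa using hj⟩)
  obtain ⟨hi, hlam⟩ : i₁ ≠ i₀ ∧ lam i₁ a ≠ 0 := by simpa using hi₁
  let μ : ι → F := fun j => if j = i₀ ∨ j = i₁ then 0 else lam j a / lam i₁ a
  have hμ₁ : μ i₁ = 0 := by simp [μ]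
  refine ⟨i₁, _, _, hi, h.triangular hv₀ hi μ (by simp [μ]) hμ₁ ?_, ?_, ?_, ?_⟩
  · intro j hj
    by_cases hj' : j = i₀ ∨ j = i₁
    · simp [μ, hj'] at hj
    · refine hmin j ?_
      have : lam j a ≠ 0 := fun h0 => hj (by simp [μ, h0])
      simpa [this] using fun h0 => hj' (Or.inl h0)
  · intro j hj hj'
    simp [μ, hj, hj', hlam]
  · simpa [hμ₁] using hlam
  · intro v
    constructor
    · intro hv j hj
      have h1 : lam i₁ v = 0 := by simpa [hμ₁] using hv i₁ hi
      simpa [h1] using hv j hj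
    · intro hv j hj
      simp [hv j hj, hv i₁ hi]

end Adapted

/-! ### Adjoining one vector to the treated space -/

section Extension

variable {F V K ι : Type*} [Field F] [AddCommGroup V] [Module F V] [Field K] [Fintype K]
  [Algebra K F] [Module K V]

open Polynomial in
theorem monic_X_pow_sub_C_mul_X {S : Type*} [CommRing S] [Nontrivial S] (b : S) {q : ℕ}
    (hq : 1 < q) : (X ^ q - C b * X : S[X]).Monic ∧ (X ^ q - C b * X : S[X]).natDegree = q := by
  have h1 : (C b * X : S[X]).natDegree < (X ^ q : S[X]).natDegree := by
    rw [natDegree_X_pow]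
    exact ((natDegree_C_mul_le b X).trans natDegree_X_le).trans_lt hq
  refine ⟨(monic_X_pow q).sub_of_left (degree_lt_degree h1), ?_⟩
  rw [natDegree_sub_eq_left_of_natDegree_lt h1, natDegree_X_pow]

theorem aeval_X_pow_sub_C_mul_X {S R : Type*} [CommRing S] [CommRing R] [Algebra S R] (r : R)
    (b : S) (q : ℕ) : Polynomial.aeval r (Polynomial.X ^ q - Polynomial.C b * Polynomial.X) =
      r ^ q - algebraMap S R b * r := by
  simp

-- The polynomial is additive in `X`, by Frobenius, and vanishes at the `K`-multiples of `s`.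
open Polynomial in
theorem X_pow_sub_C_mul_X_comp {F K S : Type*} [Field F] [Field K] [Fintype K] [Algebra K F]
    [CommRing S] [Algebra F S] (s : S) (c : K) :
    (X ^ Fintype.card K - C (s ^ (Fintype.card K - 1)) * X : S[X]).comp
      (X + C (algebraMap K F c • s)) =
      X ^ Fintype.card K - C (s ^ (Fintype.card K - 1)) * X := by
  have hq' : Fintype.card K - 1 + 1 = Fintype.card K := Nat.sub_add_cancel Fintype.card_pos
  simp only [sub_comp, mul_comp, pow_comp, X_comp, C_comp]
  rw [add_pow_card_of_algebra F (K := K), mul_add, ← map_pow, ← map_mul, _root_.smul_pow,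
    algebraMap_pow_card, mul_smul_comm, ← pow_succ, hq']
  ring

/-- If `f` is adapted and `a` is a vector that only `f i₁` detects, then a family adapted to the
larger space spanned by `a` is obtained by changing only `f i₁`. -/
theorem IsAdapted.extend [DecidableEq ι] [IsScalarTower K F V] {ℓ : Dual F V} {v₀ : V} {i₀ i₁ : ι}
    {f : ι → PolyRing F V} {m : ι → ℕ} {lam : ι → V →ₗ[K] F} (h : IsAdapted K ℓ v₀ i₀ f m lam)
    (hv₀ : ℓ v₀ = 1) (hi : i₁ ≠ i₀) {a : V} (ha : ℓ a = 0)
    (ha₀ : ∀ j, j ≠ i₀ → j ≠ i₁ → lam j a = 0) (ha₁ : lam i₁ a ≠ 0) :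
    ∃ (x : PolyRing F V) (m' : ι → ℕ) (lam' : ι → V →ₗ[K] F),
      IsAdapted K ℓ v₀ i₀ (Function.update f i₁ x) m' lam' ∧
      ∀ v, (∀ j, j ≠ i₀ → lam' j v = 0) ↔ ∃ c : K, ∀ j, j ≠ i₀ → lam j (v + c • a) = 0 := by
  set q := Fintype.card K with hq
  have hq1 : 1 < q := Fintype.one_lt_card
  set d := q ^ m i₁ with hd
  set μ := lam i₁ a with hμ
  -- The amount by which the shear along `a` translates `f i₁`.
  let s : adjoinOthers F f i₁ := μ • (⟨f i₀, mem_adjoinOthers hi.symm⟩ : adjoinOthers F f i₁) ^ d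
  have hs : (s : PolyRing F V) = μ • f i₀ ^ d := rfl
  have hf₀ : f i₀ ≠ 0 := h.algebraicIndependent.ne_zero i₀
  have hs0 : s ≠ 0 := by
    intro h0
    have : μ • f i₀ ^ d = 0 := by rw [← hs, h0]; rfl
    exact (smul_ne_zero ha₁ (pow_ne_zero _ hf₀)) this
  -- This is the product of `X - c s` over all `c ∈ K`.
  let Q : Polynomial (adjoinOthers F f i₁) := Polynomial.X ^ q - Polynomial.C (s ^ (q - 1)) * Polynomial.X
  obtain ⟨hQ, hQdeg⟩ := monic_X_pow_sub_C_mul_X (s ^ (q - 1)) hq1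
  have hxQ : Polynomial.aeval (f i₁) Q = f i₁ ^ q - (μ • f i₀ ^ d) ^ (q - 1) * f i₁ := by
    refine (aeval_X_pow_sub_C_mul_X _ _ _).trans ?_
    rw [map_pow]
    rfl
  -- The kernel of `x ↦ x ^ q - μ ^ (q - 1) * x` on `F` is `K μ`, so `lam₁` vanishes at `v` exactly
  -- when `lam i₁` kills some `v + c • a`.
  let lam₁ : V →ₗ[K] F := (FiniteField.frobeniusAlgHom K F).toLinearMap ∘ₗ lam i₁ -
    LinearMap.mulLeft K (μ ^ (q - 1)) ∘ₗ lam i₁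
  have hlam₁ : ∀ v, lam₁ v = lam i₁ v ^ q - μ ^ (q - 1) * lam i₁ v := fun v => rfl
  have hq' : q - 1 + 1 = q := by omega
  have hiff : ∀ v, (∀ j, j ≠ i₀ → Function.update lam i₁ lam₁ j v = 0) ↔
      ∃ c : K, ∀ j, j ≠ i₀ → lam j (v + c • a) = 0 := by
    intro v
    constructor
    · intro hv
      have h1 : lam i₁ v ^ q - μ ^ (q - 1) * lam i₁ v = 0 := by
        have := hv i₁ hi
        rwa [Function.update_self] at this
      have h2 : (-(lam i₁ v / μ)) ^ q = -(lam i₁ v / μ) := by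
        have hpos : (lam i₁ v / μ) ^ q = lam i₁ v / μ := by
          rw [div_pow, sub_eq_zero.1 h1]
          nth_rewrite 2 [← hq']
          rw [pow_succ]
          field_simp
        have h3 := add_pow_card_of_algebra F (K := K) (lam i₁ v / μ) (-(lam i₁ v / μ))
        rw [add_neg_cancel, zero_pow Fintype.card_ne_zero, ← hq, hpos] at h3
        linear_combination -h3
      obtain ⟨c, hc⟩ := exists_algebraMap_eq_of_pow_card_eq h2
      refine ⟨c, fun j hj => ?_⟩
      rw [map_add, map_smul, Algebra.smul_def, hc]
      by_cases hj' : j = i₁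
      · rw [hj', ← hμ]
        field_simp
        ring
      · have := hv j hj
        rw [Function.update_of_ne hj'] at this
        rw [this, ha₀ j hj hj', mul_zero, add_zero]
    · rintro ⟨c, hc⟩ j hj
      by_cases hj' : j = i₁
      · subst hj'
        have h1 := hc j hj
        rw [map_add, map_smul, Algebra.smul_def, ← hμ] at h1
        have h2 : lam j v = algebraMap K F (-c) * μ := by
          rw [map_neg]
          linear_combination h1
        rw [Function.update_self, hlam₁, h2, mul_pow, algebraMap_pow_card]
        nth_rewrite 1 [← hq']
        ring
      · have := hc j hj
        rw [map_add, map_smul, ha₀ j hj hj', smul_zero, add_zero] at this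
        rw [Function.update_of_ne hj']
        exact this
  refine ⟨Polynomial.aeval (f i₁) Q, Function.update m i₁ (m i₁ + 1),
    Function.update lam i₁ lam₁, ?_, hiff⟩
  constructor
  · rw [Function.update_of_ne hi.symm, h.eq_ι]
  · intro j hj
    by_cases hj' : j = i₁
    · subst hj'
      rw [Function.update_self, Function.update_self, hxQ, pow_succ]
      refine sub_mem (pow_mem_homogeneousPart (h.homogeneous j hj) q) ?_
      rw [smul_pow, smul_mul_assoc]
      refine Submodule.smul_mem _ _ ?_
      have := mul_mem_homogeneousPart (pow_mem_homogeneousPart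
        (ι_pow_mem_homogeneousPart ℓ d) (q - 1)) (h.homogeneous j hj)
      rw [← h.eq_ι] at this
      convert this using 1
      rw [← hq, ← hd]
      rw [← Nat.mul_succ, Nat.succ_eq_add_one, hq']
    · rw [Function.update_of_ne hj', Function.update_of_ne hj']
      exact h.homogeneous j hj
  · intro j hj v hv
    by_cases hj' : j = i₁
    · subst hj'
      rw [Function.update_self, Function.update_self, Function.update_self,
        Function.update_of_ne hj.symm, hxQ]
      simp only [map_sub, map_mul, map_pow, map_smul, h.translate j hj v hv, h.shear_base hv]
      rw [add_pow_card_of_algebra F (K := K), ← hq, ← hd, hlam₁, smul_pow, smul_pow,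
        pow_succ, ← hd, ← pow_mul (f i₀) d q, sub_smul, mul_add, ← smul_smul]
      have : (f i₀ ^ d) ^ (q - 1) * f i₀ ^ d = f i₀ ^ (d * q) := by
        rw [← pow_succ, hq', pow_mul]
      rw [smul_mul_smul_comm, this, smul_smul]
      abel
    · rw [Function.update_of_ne hj', Function.update_of_ne hj', Function.update_of_ne hj',
        Function.update_of_ne hi.symm]
      exact h.translate j hj v hv
  · intro j hj c hc
    by_cases hj' : j = i₁
    · subst hj'
      rw [Function.update_self, hxQ]
      simp only [map_sub, map_mul, map_pow, map_smul, h.scale j hj c hc, h.scale_base hv₀]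
      have h1 : (algebraMap K F c ^ d) ^ (q - 1) = 1 := by
        rw [← pow_mul, mul_comm, pow_mul, ← map_pow, FiniteField.pow_card_sub_one_eq_one c hc,
          map_one, one_pow]
      rw [smul_pow (algebraMap K F c), smul_comm, smul_pow (algebraMap K F c ^ d), h1, one_smul]
    · rw [Function.update_of_ne hj']
      exact h.scale j hj c hc
  · exact algebraicIndependent_update_aeval h.algebraicIndependent hQ (by rw [hQdeg]; omega)
  · intro p hp
    obtain ⟨P, rfl⟩ := exists_aeval_eq_of_mem_adjoin i₁ (h.mem_adjoin p fun v hv hv' =>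
      hp v hv ((hiff v).2 ⟨0, by simpa using hv'⟩))
    refine aeval_mem_adjoin_update ?_
    classical
    -- The shears along `c • a` fix the other members and translate `f i₁` by `c • s`: `q` distinct
    -- translations, as many as the degree of `Q`.
    let D : Finset (adjoinOthers F f i₁) := Finset.univ.image fun c : K => algebraMap K F c • s
    have hinj : Function.Injective fun c : K => algebraMap K F c • s := fun c c' hcc =>
      (algebraMap K F).injective (smul_left_injective F hs0 hcc)
    refine mem_adjoin_of_comp_X_add_C hQ (by rw [hQdeg]; omega) D ?_ ?_ P ?_
    · rw [hQdeg, Finset.card_image_of_injective _ hinj, Finset.card_univ]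
    · intro e he
      obtain ⟨c, -, rfl⟩ := Finset.mem_image.1 he
      exact X_pow_sub_C_mul_X_comp s c
    · intro e he
      obtain ⟨c, -, rfl⟩ := Finset.mem_image.1 he
      refine comp_eq_self_of_algHom_eq h.algebraicIndependent (τ := shear ℓ (c • a)) ?_ ?_ ?_
      · intro j hj
        by_cases hj₀ : j = i₀
        · rw [hj₀]
          exact h.shear_base (by rw [algebra_compatible_smul F, map_smul, ha, smul_zero])
        · rw [h.translate j hj₀ _ (by rw [algebra_compatible_smul F, map_smul, ha, smul_zero]),
            map_smul, ha₀ j hj₀ hj, smul_zero, zero_smul, add_zero]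
      · rw [h.translate i₁ hi _ (by rw [algebra_compatible_smul F, map_smul, ha, smul_zero]),
          map_add, Polynomial.aeval_X, Polynomial.aeval_C, map_smul, Algebra.smul_def c,
          ← smul_smul]
        rfl
      · refine hp _ (by rw [algebra_compatible_smul F, map_smul, ha, smul_zero])
          ((hiff _).2 ⟨-c, fun j _ => ?_⟩)
        rw [neg_smul, add_neg_cancel, map_zero]

/-- Every finitely generated `K`-space of transvections about `ker ℓ` has an adapted family. -/
theorem exists_isAdapted [Fintype ι] [DecidableEq ι] [IsScalarTower K F V] {ℓ : Dual F V} {v₀ : V}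
    {i₀ : ι} (hv₀ : ℓ v₀ = 1) (b : Basis ι F (Dual F V)) (hℓ : b i₀ = ℓ)
    (hb : ∀ j, j ≠ i₀ → b j v₀ = 0) {B : Set V} (hB : B.Finite) (hBℓ : ∀ v ∈ B, ℓ v = 0) :
    ∃ (f : ι → PolyRing F V) (m : ι → ℕ) (lam : ι → V →ₗ[K] F), IsAdapted K ℓ v₀ i₀ f m lam ∧
      ∀ v, ℓ v = 0 → ((∀ j, j ≠ i₀ → lam j v = 0) ↔ v ∈ Submodule.span K B) := by
  induction B, hB using Set.Finite.induction_on with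
  | empty =>
    refine ⟨_, _, _, IsAdapted.of_basis b hℓ hb, fun v hv => ?_⟩
    rw [Submodule.span_empty, Submodule.mem_bot]
    refine ⟨fun hv' => ?_, fun hv' => by simp [hv']⟩
    have h1 : Dual.eval F V v = 0 := b.ext fun j => by
      by_cases hj : j = i₀
      · rw [hj, hℓ]
        exact hv
      · exact hv' j hj
    exact (forall_dual_apply_eq_zero_iff F v).1 fun φ => DFunLike.congr_fun h1 φ
  | @insert a B _ _ ih =>
    obtain ⟨f, m, lam, h, hlam⟩ := ih fun v hv => hBℓ v (Set.mem_insert_of_mem _ hv)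
    have ha := hBℓ a (Set.mem_insert _ _)
    by_cases hex : ∃ j, j ≠ i₀ ∧ lam j a ≠ 0
    · obtain ⟨i₁, f', lam', hi, h', h0, h1, hiff⟩ := h.exists_normalized hv₀ hex
      obtain ⟨x, m'', lam'', h'', hiff''⟩ := h'.extend hv₀ hi ha h0 h1
      refine ⟨_, _, _, h'', fun v hv => ?_⟩
      rw [hiff'', Submodule.mem_span_insert']
      refine exists_congr fun c => ?_
      rw [hiff, hlam]
      rw [map_add, hv, algebra_compatible_smul F, map_smul, ha, smul_zero, add_zero]
    · push Not at hex
      refine ⟨f, m, lam, h, fun v hv => ?_⟩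
      rw [Submodule.span_insert_eq_span ((hlam a ha).1 hex)]
      exact hlam v hv

end Extension

/-! ### Structure of a finite group fixing a hyperplane pointwise -/

section Action

variable {F V : Type*} [Field F] [AddCommGroup V] [Module F V]

theorem act_one (p : PolyRing F V) : act (1 : V ≃ₗ[F] V) p = p := by
  have : act (1 : V ≃ₗ[F] V) = AlgHom.id F (PolyRing F V) := by
    refine algHom_ext_ι fun φ => ?_
    rw [act_ι]
    rfl
  exact DFunLike.congr_fun this p

theorem act_mul (g h : V ≃ₗ[F] V) (p : PolyRing F V) : act (g * h) p = act g (act h p) := by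
  have : act (g * h) = (act g).comp (act h) := by
    refine algHom_ext_ι fun φ => ?_
    rw [AlgHom.comp_apply, act_ι, act_ι, act_ι]
    rfl
  exact DFunLike.congr_fun this p

/-- The subgroup of `GL(V)` that fixes the polynomial `p`. -/
noncomputable def fixer (p : PolyRing F V) : Subgroup (V ≃ₗ[F] V) where
  carrier := {g | act g p = p}
  mul_mem' {g h} hg hh := by
    change act (g * h) p = p
    rw [act_mul, hh, hg]
  one_mem' := act_one p
  inv_mem' {g} hg := by
    change act g⁻¹ p = p
    conv_lhs => rw [← show act g p = p from hg]
    rw [← act_mul, inv_mul_cancel, act_one]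

theorem mem_fixer {g : V ≃ₗ[F] V} {p : PolyRing F V} : g ∈ fixer p ↔ act g p = p := Iff.rfl

theorem mem_invariants_iff_le_fixer {G : Subgroup (V ≃ₗ[F] V)} {p : PolyRing F V} :
    p ∈ invariants G ↔ G ≤ fixer p := Iff.rfl

theorem mem_fixer_iff_shear {ℓ : Dual F V} {b : V} {g : V ≃ₗ[F] V} {p : PolyRing F V}
    (hg : ∀ v, g v = v + ℓ v • b) : g ∈ fixer p ↔ shear ℓ b p = p := by
  rw [← inv_mem_iff, mem_fixer, act_inv_eq_shear hg]

theorem apply_eq_of_fixes_ker {ℓ : Dual F V} {v₀ : V} (hv₀ : ℓ v₀ = 1) {g : V ≃ₗ[F] V}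
    (hg : ∀ v, ℓ v = 0 → g v = v) (v : V) : g v = v + ℓ v • (g v₀ - v₀) := by
  have := hg (v - ℓ v • v₀) (by simp [hv₀])
  rw [map_sub, map_smul, sub_eq_iff_eq_add] at this
  rw [this, smul_sub]
  abel

/-- The vectors `b` in the kernel of `ℓ` for which the transvection `v ↦ v + ℓ v • b` lies in `G`. -/
def transvectionVectors (ℓ : Dual F V) (G : Subgroup (V ≃ₗ[F] V)) : AddSubgroup V where
  carrier := {b | ℓ b = 0 ∧ ∃ g ∈ G, ∀ v, g v = v + ℓ v • b}
  add_mem' := by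
    rintro a b ⟨ha, g, hg, hga⟩ ⟨hb, h, hh, hhb⟩
    refine ⟨by rw [map_add, ha, hb, add_zero], g * h, mul_mem hg hh, fun v => ?_⟩
    rw [LinearEquiv.mul_apply, hhb, hga, map_add, map_smul, hb, smul_zero, add_zero, smul_add]
    abel
  zero_mem' := ⟨map_zero _, 1, one_mem _, fun v => by simp⟩
  neg_mem' := by
    rintro b ⟨hb, g, hg, hgb⟩
    refine ⟨by rw [map_neg, hb, neg_zero], g⁻¹, inv_mem hg, fun v => ?_⟩
    refine g.injective ?_
    rw [hgb (v + ℓ v • -b), map_add, map_smul, map_neg, hb, ← LinearEquiv.mul_apply, mul_inv_cancel,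
      LinearEquiv.coe_one, id]
    simp

theorem transvectionVectors_finite {ℓ : Dual F V} {v₀ : V} (hv₀ : ℓ v₀ = 1)
    {G : Subgroup (V ≃ₗ[F] V)} (hG : Finite G) : (transvectionVectors ℓ G : Set V).Finite := by
  refine (Set.finite_range fun g : G => (g : V ≃ₗ[F] V) v₀ - v₀).subset ?_
  rintro b ⟨_, g, hg, hgb⟩
  exact ⟨⟨g, hg⟩, by simp [hgb v₀, hv₀]⟩

/-- The transvection vectors of `G` are stable under the eigenvalue `ζ` of a reflection in `G`. -/
theorem smul_mem_transvectionVectors {ℓ : Dual F V} {v₀ : V} (hv₀ : ℓ v₀ = 1)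
    {G : Subgroup (V ≃ₗ[F] V)} (hGH : ∀ g ∈ G, ∀ v, ℓ v = 0 → g v = v) {g₀ : V ≃ₗ[F] V}
    (hg₀ : g₀ ∈ G) {ζ : F} (hζ : g₀ v₀ = ζ • v₀) {b : V} (hb : b ∈ transvectionVectors ℓ G) :
    ζ • b ∈ transvectionVectors ℓ G := by
  obtain ⟨hb, g, hg, hgb⟩ := hb
  have hℓ : ∀ v, ℓ (g₀ v) = ζ * ℓ v := by
    intro v
    rw [apply_eq_of_fixes_ker hv₀ (hGH g₀ hg₀) v, hζ]
    simp [hv₀]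
    ring
  -- Conjugation scales the vector: `ℓ ∘ g₀ = ζ ℓ`, and `g₀` fixes `b ∈ ker ℓ`.
  refine ⟨by rw [map_smul, hb, smul_zero], g₀⁻¹ * g * g₀,
    mul_mem (mul_mem (inv_mem hg₀) hg) hg₀, fun v => ?_⟩
  refine g₀.injective ?_
  rw [← LinearEquiv.mul_apply, mul_assoc, mul_inv_cancel_left, LinearEquiv.mul_apply, hgb, hℓ,
    map_add, map_smul, map_smul, hGH g₀ hg₀ b hb, smul_smul, mul_comm]

/-- A finite group that fixes the kernel of `ℓ` pointwise contains a reflection with eigenvector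
`v₀` outside of the kernel, whose eigenvalue generates the group of all determinants. -/
theorem exists_generating_reflection {ℓ : Dual F V} (hℓ : ℓ ≠ 0) {G : Subgroup (V ≃ₗ[F] V)}
    (hG : Finite G) (hGH : ∀ g ∈ G, ∀ v, ℓ v = 0 → g v = v) :
    ∃ (v₀ : V) (g₀ : V ≃ₗ[F] V) (ζ : F), ℓ v₀ = 1 ∧ g₀ ∈ G ∧ g₀ v₀ = ζ • v₀ ∧ IsOfFinOrder ζ ∧
      ∀ g ∈ G, ∃ k : ℕ, ℓ (g v₀) = ζ ^ k := by
  obtain ⟨v₁, hv₁⟩ : ∃ v₁, ℓ v₁ = 1 := LinearMap.surjective hℓ 1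
  -- The scalar by which `g` acts on `V / ker ℓ`, that is, its determinant; a finite group of such
  -- scalars is cyclic.
  let ε : G →* F :=
    { toFun := fun g => ℓ ((g : V ≃ₗ[F] V) v₁)
      map_one' := hv₁
      map_mul' := fun g h => by
        rw [Subgroup.coe_mul, LinearEquiv.mul_apply,
          apply_eq_of_fixes_ker hv₁ (hGH g g.2) ((h : V ≃ₗ[F] V) v₁)]
        simp [hv₁]
        ring }
  have hε : ∀ g : G, ε g = ℓ ((g : V ≃ₗ[F] V) v₁) := fun _ => rfl
  have : Finite ε.toHomUnits.range :=
    Finite.of_surjective _ ε.toHomUnits.rangeRestrict_surjective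
  obtain ⟨⟨_, ⟨g₀, rfl⟩⟩, hgen⟩ := IsCyclic.exists_monoid_generator (α := ε.toHomUnits.range)
  have hpow : ∀ g : G, ∃ k : ℕ, ε g = ε g₀ ^ k := by
    intro g
    obtain ⟨k, hk⟩ := hgen ⟨_, ⟨g, rfl⟩⟩
    refine ⟨k, ?_⟩
    have := congrArg (fun u : ε.toHomUnits.range => ((u : Fˣ) : F)) hk
    simpa using this.symm
  have hfin : IsOfFinOrder (ε g₀) := ε.isOfFinOrder (isOfFinOrder_of_finite g₀)
  have hchange : ∀ v₀, ℓ v₀ = 1 → ∀ g : G, ℓ ((g : V ≃ₗ[F] V) v₀) = ε g := by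
    intro v₀ hv₀ g
    rw [apply_eq_of_fixes_ker hv₁ (hGH g g.2) v₀, hε]
    simp [hv₀, hv₁]
  by_cases h1 : ε g₀ = 1
  · refine ⟨v₁, 1, 1, hv₁, one_mem _, by simp, IsOfFinOrder.one, fun g hg => ⟨0, ?_⟩⟩
    obtain ⟨k, hk⟩ := hpow ⟨g, hg⟩
    rw [h1, one_pow, hε] at hk
    rw [hk, pow_zero]
  · have hne : ε g₀ - 1 ≠ 0 := sub_ne_zero.2 h1
    -- As `w` is fixed by `g₀`, adding `(ε g₀ - 1)⁻¹ • w` corrects `v₁` to an eigenvector.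
    set w := (g₀ : V ≃ₗ[F] V) v₁ - ε g₀ • v₁ with hw
    have hℓw : ℓ w = 0 := by simp [hw, hv₁, hε]
    have hv₀ : ℓ (v₁ + (ε g₀ - 1)⁻¹ • w) = 1 := by simp [hv₁, hℓw]
    refine ⟨v₁ + (ε g₀ - 1)⁻¹ • w, g₀, ε g₀, hv₀, g₀.2, ?_, hfin, fun g hg => ?_⟩
    · have hg₀ : (g₀ : V ≃ₗ[F] V) v₁ = w + ε g₀ • v₁ := by rw [hw, sub_add_cancel]
      rw [map_add, map_smul, hGH g₀ g₀.2 w hℓw, hg₀]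
      have : w = (ε g₀ - 1) • (ε g₀ - 1)⁻¹ • w := by rw [smul_smul, mul_inv_cancel₀ hne, one_smul]
      nth_rewrite 1 [this]
      module
    · obtain ⟨k, hk⟩ := hpow ⟨g, hg⟩
      exact ⟨k, by rw [← hk, ← hchange _ hv₀ ⟨g, hg⟩]⟩

/-- Dividing `g ∈ G` by the power of `g₀` with the same determinant leaves a shear along a vector of
`ker ℓ`, so such shears and `g₀` generate `G`. -/
theorem mem_invariants_iff_shear {ℓ : Dual F V} {v₀ : V} (hv₀ : ℓ v₀ = 1)
    {G : Subgroup (V ≃ₗ[F] V)} (hGH : ∀ g ∈ G, ∀ v, ℓ v = 0 → g v = v) {g₀ : V ≃ₗ[F] V}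
    (hg₀ : g₀ ∈ G) {ζ : F} (hζ : g₀ v₀ = ζ • v₀) (hpow : ∀ g ∈ G, ∃ k : ℕ, ℓ (g v₀) = ζ ^ k)
    (hζ0 : ζ ≠ 0) {p : PolyRing F V} :
    p ∈ invariants G ↔ (∀ b ∈ transvectionVectors ℓ G, shear ℓ b p = p) ∧
      shear ℓ ((ζ - 1) • v₀) p = p := by
  have hg₀v : ∀ v, g₀ v = v + ℓ v • ((ζ - 1) • v₀) := fun v => by
    rw [apply_eq_of_fixes_ker hv₀ (hGH g₀ hg₀) v, hζ, sub_smul, one_smul]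
  rw [mem_invariants_iff_le_fixer]
  constructor
  · intro hp
    refine ⟨?_, (mem_fixer_iff_shear hg₀v).1 (hp hg₀)⟩
    rintro b ⟨_, g, hg, hgb⟩
    exact (mem_fixer_iff_shear hgb).1 (hp hg)
  · rintro ⟨h1, h2⟩ g hg
    have h3 : g₀ ∈ fixer p := (mem_fixer_iff_shear hg₀v).2 h2
    obtain ⟨k, hk⟩ := hpow g hg
    have hu : g * (g₀ ^ k)⁻¹ ∈ G := mul_mem hg (inv_mem (pow_mem hg₀ k))
    have hg₀k : ∀ n : ℕ, (g₀ ^ n) v₀ = ζ ^ n • v₀ := by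
      intro n
      induction n with
      | zero => simp
      | succ n ih =>
        rw [pow_succ', LinearEquiv.mul_apply, ih, map_smul, hζ, smul_smul, pow_succ]
    have hinv : (g₀ ^ k)⁻¹ v₀ = (ζ ^ k)⁻¹ • v₀ := by
      refine (g₀ ^ k).injective ?_
      rw [map_smul, hg₀k, smul_smul, inv_mul_cancel₀ (pow_ne_zero _ hζ0), one_smul,
        ← LinearEquiv.mul_apply, mul_inv_cancel]
      rfl
    have hmem : (g * (g₀ ^ k)⁻¹) v₀ - v₀ ∈ transvectionVectors ℓ G := by
      refine ⟨?_, _, hu, apply_eq_of_fixes_ker hv₀ (hGH _ hu)⟩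
      rw [map_sub, LinearEquiv.mul_apply, hinv, map_smul, map_smul, hk, hv₀, smul_eq_mul,
        inv_mul_cancel₀ (pow_ne_zero _ hζ0), sub_self]
    have h4 : g * (g₀ ^ k)⁻¹ ∈ fixer p :=
      (mem_fixer_iff_shear (apply_eq_of_fixes_ker hv₀ (hGH _ hu))).2 (h1 _ hmem)
    have := mul_mem h4 (pow_mem h3 k)
    rwa [inv_mul_cancel_right] at this

/-- The scalars `c` for which the transvection along `c • a` fixes `p`. -/
def fixingScalars (ℓ : Dual F V) {a : V} (ha : ℓ a = 0) (p : PolyRing F V) :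
    AddSubgroup F where
  carrier := {c | shear ℓ (c • a) p = p}
  add_mem' {c d} hc hd := by
    have := shear_shear ℓ (c • a) (d • a) p
    rw [hd, hc, map_smul, ha, smul_zero, add_zero, one_smul, ← add_smul] at this
    exact this.symm
  zero_mem' := by
    change shear ℓ ((0 : F) • a) p = p
    rw [zero_smul, shear_zero]
  neg_mem' {c} hc := by
    have := shear_shear ℓ (-c • a) (c • a) p
    rw [hc, map_smul, ha, smul_zero, add_zero, one_smul, ← add_smul, neg_add_cancel, zero_smul,
      shear_zero] at this
    exact this

/-- The dilatation of ratio `ζ` intertwines the shears along `b` and `ζ • b`. Thus the scalars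
fixing `p` are closed under `ζ`, with no need to know the group `G'` itself. -/
theorem shear_smul_eigenvalue {ℓ : Dual F V} {v₀ : V} (hv₀ : ℓ v₀ = 1) {ζ : F} {p : PolyRing F V}
    (hζ : shear ℓ ((ζ - 1) • v₀) p = p) {b : V} (hb : ℓ b = 0) (hp : shear ℓ b p = p) :
    shear ℓ (ζ • b) p = p := by
  have h1 := shear_shear ℓ ((ζ - 1) • v₀) b p
  have h2 := shear_shear ℓ (ζ • b) ((ζ - 1) • v₀) p
  rw [hp, hζ, map_smul, hv₀, smul_eq_mul, mul_one, add_sub_cancel] at h1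
  rw [hζ, map_smul, hb, smul_zero, add_zero, one_smul, add_comm, ← h1] at h2
  exact h2

end Action

/-! ### The finite field, the coordinates and the passage to basic invariants -/

/-- An element of finite order of a field of positive characteristic generates a finite subfield,
additively spanned by its powers. -/
theorem exists_finite_subfield {F : Type*} [Field F] {n : ℕ} (hn : 0 < n) (hn0 : (n : F) = 0)
    {ζ : F} (hζ : IsOfFinOrder ζ) :
    ∃ K : Subfield F, Finite K ∧ ζ ∈ K ∧
      ∀ M : AddSubgroup F, 1 ∈ M → (∀ x ∈ M, ζ * x ∈ M) → ∀ x ∈ K, x ∈ M := by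
  obtain ⟨p, hp⟩ := CharP.exists F
  have hp0 : p ≠ 0 := by
    rintro rfl
    exact hn.ne' (Nat.eq_zero_of_zero_dvd ((CharP.cast_eq_zero_iff F 0 n).1 hn0))
  have : Fact p.Prime := ⟨(CharP.char_is_prime_or_zero F p).resolve_right hp0⟩
  let _ := ZMod.algebra F p
  have hint : IsIntegral (ZMod p) ζ := by
    obtain ⟨k, hk, hk1⟩ := isOfFinOrder_iff_pow_eq_one.1 hζ
    exact IsIntegral.of_pow hk (hk1 ▸ isIntegral_one)
  let L := IntermediateField.adjoin (ZMod p) {ζ}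
  have : FiniteDimensional (ZMod p) L := IntermediateField.adjoin.finiteDimensional hint
  refine ⟨L.toSubfield, Module.finite_of_finite (ZMod p) (M := L),
    IntermediateField.mem_adjoin_simple_self _ _, ?_⟩
  intro M h1 hM x hx
  have hx' : x ∈ L.toSubalgebra := hx
  rw [IntermediateField.adjoin_simple_toSubalgebra_of_isAlgebraic hint.isAlgebraic,
    Algebra.adjoin_singleton_eq_range_aeval] at hx'
  obtain ⟨P, rfl⟩ := hx'
  have hpow : ∀ k : ℕ, ζ ^ k ∈ M := by
    intro k
    induction k with
    | zero => simpa using h1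
    | succ k ih =>
      rw [pow_succ']
      exact hM _ ih
  clear hx
  change Polynomial.aeval ζ P ∈ M
  induction P using Polynomial.induction_on' with
  | add P Q hP hQ =>
    rw [map_add]
    exact add_mem hP hQ
  | monomial k a =>
    rw [Polynomial.aeval_monomial, ← ZMod.natCast_zmod_val a, map_natCast, ← nsmul_eq_mul]
    exact nsmul_mem (hpow k) _

/-- A linear form with value `1` at `v₀` can be completed to a basis of the dual space by forms that
vanish at `v₀`. -/
theorem exists_basis_dual {F V : Type*} [Field F] [AddCommGroup V] [Module F V]
    [FiniteDimensional F V] {ℓ : Dual F V} {v₀ : V} (hv₀ : ℓ v₀ = 1) :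
    ∃ (b : Basis (Fin (finrank F V)) F (Dual F V)) (i₀ : Fin (finrank F V)),
      b i₀ = ℓ ∧ ∀ j, j ≠ i₀ → b j v₀ = 0 := by
  let N : Submodule F (Dual F V) := LinearMap.ker (Dual.eval F V v₀)
  have : Free F N := Free.of_divisionRing F N
  have hN : ∀ φ, φ ∈ N ↔ φ v₀ = 0 := fun φ => Iff.rfl
  -- The dual space is the direct sum of `F ℓ` and the annihilator `N` of `v₀`.
  let b := Basis.mkFinCons ℓ (finBasis F N)
    (fun c φ hφ h => by
      have := DFunLike.congr_fun h v₀
      simpa [(hN φ).1 hφ, hv₀] using this)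
    (fun φ => ⟨-φ v₀, by rw [hN]; simp [hv₀]⟩)
  have hcard : finrank F N + 1 = finrank F V := by
    rw [← Subspace.dual_finrank_eq (K := F) (V := V), finrank_eq_card_basis b, Fintype.card_fin]
  refine ⟨b.reindex (finCongr hcard), finCongr hcard 0, ?_, ?_⟩
  · simp [b]
  · intro j hj
    obtain ⟨k, rfl⟩ := (finCongr hcard).surjective j
    have hk : k ≠ 0 := fun h => hj (by rw [h])
    obtain ⟨l, rfl⟩ := Fin.exists_succ_eq.2 hk
    rw [Basis.reindex_apply, Equiv.symm_apply_apply, Basis.coe_mkFinCons, Fin.cons_succ]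
    exact (finBasis F N l).2

/-- Replacing `ℓ` in an adapted family by its power of exponent the order of `ζ` yields basic
invariants for a group generated by transvections and a dilatation of ratio `ζ`. -/
theorem IsAdapted.isBasicInvariants {F V K : Type*} [Field F] [AddCommGroup V] [Module F V]
    [Field K] [Fintype K] [Algebra K F] [Module K V] {ℓ : Dual F V} {v₀ : V}
    {i₀ : Fin (finrank F V)} {f : Fin (finrank F V) → PolyRing F V} {m : Fin (finrank F V) → ℕ}
    {lam : Fin (finrank F V) → V →ₗ[K] F} (h : IsAdapted K ℓ v₀ i₀ f m lam) (hv₀ : ℓ v₀ = 1)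
    {ζ : K} (hζ : IsOfFinOrder ζ) {G : Subgroup (V ≃ₗ[F] V)}
    (hG : ∀ p, p ∈ invariants G ↔
      (∀ v, ℓ v = 0 → (∀ j, j ≠ i₀ → lam j v = 0) → shear ℓ v p = p) ∧
        shear ℓ ((algebraMap K F ζ - 1) • v₀) p = p) :
    IsBasicInvariants G (Function.update f i₀ (f i₀ ^ orderOf ζ)) := by
  have he : orderOf ζ ≠ 0 := hζ.orderOf_pos.ne'
  have hζ0 : ζ ≠ 0 := hζ.isUnit.ne_zero
  have hX : f i₀ ^ orderOf ζ =
      Polynomial.aeval (f i₀) (Polynomial.X ^ orderOf ζ : Polynomial (adjoinOthers F f i₀)) :=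
    (Polynomial.aeval_X_pow _).symm
  constructor
  · intro j
    by_cases hj : j = i₀
    · subst hj
      rw [Function.update_self, h.eq_ι]
      exact ⟨_, ι_pow_mem_homogeneousPart ℓ _⟩
    · rw [Function.update_of_ne hj]
      exact ⟨_, h.homogeneous j hj⟩
  · rw [hX]
    refine algebraicIndependent_update_aeval h.algebraicIndependent (Polynomial.monic_X_pow _) ?_
    rwa [Polynomial.natDegree_X_pow]
  · apply le_antisymm
    · intro p hp
      obtain ⟨h1, h2⟩ := (hG p).1 hp
      obtain ⟨P, rfl⟩ := exists_aeval_eq_of_mem_adjoin i₀ (h.mem_adjoin p h1)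
      rw [hX]
      refine aeval_mem_adjoin_update ?_
      refine mem_adjoin_of_comp_C_mul_X
        (ζ := algebraMap F (adjoinOthers F f i₀) (algebraMap K F ζ)) ?_ P ?_
      · intro n hn
        rw [← map_pow, ← map_pow] at hn
        refine orderOf_dvd_of_pow_eq_one ((algebraMap K F).injective ?_)
        refine (algebraMap F (adjoinOthers F f i₀)).injective ?_
        rw [hn, map_one, map_one]
      · refine comp_eq_self_of_algHom_eq h.algebraicIndependent
          (fun j hj => h.scale j hj ζ hζ0) ?_ h2
        rw [h.scale_base hv₀, map_mul, Polynomial.aeval_X, Polynomial.aeval_C, Algebra.smul_def]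
        rfl
    · refine Algebra.adjoin_le ?_
      rintro _ ⟨j, rfl⟩
      refine (hG _).2 ?_
      by_cases hj : j = i₀
      · subst hj
        rw [Function.update_self, map_pow, h.scale_base hv₀, smul_pow, ← map_pow,
          pow_orderOf_eq_one, map_one, one_smul]
        exact ⟨fun v hv _ => by rw [map_pow, h.shear_base hv], rfl⟩
      · rw [Function.update_of_ne hj]
        refine ⟨fun v hv hv' => ?_, h.scale j hj ζ hζ0⟩
        rw [h.translate j hj v hv, hv' j hj, zero_smul, add_zero]

/-- A transvection about the kernel of `ℓ` has the form `v ↦ v + ℓ v • a` with `a ≠ 0` in the kernel,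
and forces positive characteristic. -/
theorem IsTransvectionAbout.exists_vector {F V : Type*} [Field F] [AddCommGroup V] [Module F V]
    [FiniteDimensional F V] {ℓ : Dual F V} {v₀ : V} (hv₀ : ℓ v₀ = 1) {t : V ≃ₗ[F] V}
    (ht : IsTransvectionAbout (LinearMap.ker ℓ) t) :
    ∃ a, ℓ a = 0 ∧ (∀ v, t v = v + ℓ v • a) ∧ ∃ n : ℕ, 0 < n ∧ (n : F) = 0 := by
  have hta := apply_eq_of_fixes_ker hv₀ (g := t) ht.fixes
  set a := t v₀ - v₀ with ha
  have hℓa : ℓ a = 0 := by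
    -- The determinant of this map is `1 + ℓ a`.
    have h1 : (t : V →ₗ[F] V) = LinearMap.transvection ℓ a := LinearMap.ext fun v => hta v
    have h2 := ht.det_eq_one
    rw [h1, LinearMap.transvection.det] at h2
    simpa using h2
  have ha0 : a ≠ 0 := by
    intro h0
    refine ht.ne_one (LinearEquiv.ext fun v => ?_)
    rw [hta v, h0, smul_zero, add_zero]
    rfl
  obtain ⟨n, hn, hn1⟩ := isOfFinOrder_iff_pow_eq_one.1 ht.isOfFinOrder
  refine ⟨a, hℓa, hta, n, hn, ?_⟩
  have hpow : ∀ k : ℕ, (t ^ k) v₀ = v₀ + (k : F) • a := by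
    intro k
    induction k with
    | zero => simp
    | succ k ih =>
      rw [pow_succ', LinearEquiv.mul_apply, ih, hta]
      simp only [map_add, map_smul, hv₀, hℓa, Nat.cast_succ]
      module
  have h3 := hpow n
  rw [hn1, LinearEquiv.coe_one, id, left_eq_add] at h3
  exact (smul_eq_zero.1 h3).resolve_right ha0

theorem exists_ker_eq_of_isCoatom {F V : Type*} [Field F] [AddCommGroup V] [Module F V]
    {H : Submodule F V} (hH : IsCoatom H) : ∃ ℓ : Dual F V, ℓ ≠ 0 ∧ LinearMap.ker ℓ = H := by
  obtain ⟨ℓ, hℓ, hle⟩ := Submodule.exists_le_ker_of_lt_top H hH.lt_top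
  refine ⟨ℓ, hℓ, (hH.le_iff.1 hle).resolve_left fun h => hℓ (LinearMap.ker_eq_top.1 h)⟩

end LinInv

/-! ### The main theorem -/

theorem mainTheorem4 {F V : Type*} [Field F] [AddCommGroup V] [Module F V]
    [FiniteDimensional F V]
    (H : Submodule F V) (hH : IsCoatom H)
    (G : Subgroup (V ≃ₗ[F] V)) (hGfin : Finite G) (hGH : ∀ g ∈ G, ∀ v ∈ H, g v = v)
    (t : V ≃ₗ[F] V) (ht : LinInv.IsTransvectionAbout H t) (htG : t ∉ G)
    (G' : Subgroup (V ≃ₗ[F] V)) (hG' : G' = Subgroup.closure ((G : Set (V ≃ₗ[F] V)) ∪ {t})) :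
    ∃ (f : Fin (Module.finrank F V) → LinInv.PolyRing F V)
      (i : Fin (Module.finrank F V)) (f' : LinInv.PolyRing F V),
      LinInv.IsBasicInvariants G f ∧
      f' ∈ LinInv.invariants G' ∧
      LinInv.IsBasicInvariants G' (Function.update f i f') ∧
      ∀ j, j ≠ i → f j ∈ LinInv.invariants G' := by
  open LinInv in
  obtain ⟨ℓ, hℓ, rfl⟩ := exists_ker_eq_of_isCoatom hH
  obtain ⟨v₀, g₀, ζ, hv₀, hg₀, hζ, hζfin, hpow⟩ := exists_generating_reflection hℓ hGfin hGH
  obtain ⟨a, ha, hta, n, hn, hn0⟩ := ht.exists_vector hv₀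
  obtain ⟨K, hK, hζK, hKind⟩ := exists_finite_subfield hn hn0 hζfin
  have hζ0 : ζ ≠ 0 := hζfin.isUnit.ne_zero
  let _ : Fintype K := Fintype.ofFinite K
  obtain ⟨b, i₀, hb, hb₀⟩ := exists_basis_dual hv₀
  obtain ⟨f, m, lam, h, hlam⟩ := exists_isAdapted (K := K) hv₀ b hb hb₀
    (transvectionVectors_finite hv₀ hGfin) fun v hv => hv.1
  have hsmul : ∀ c ∈ K, ∀ v ∈ transvectionVectors ℓ G, c • v ∈ transvectionVectors ℓ G := by
    intro c hc v hv
    refine hKind ((transvectionVectors ℓ G).comap (LinearMap.toSpanSingleton F V v).toAddMonoidHom)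
      ?_ ?_ c hc
    · simpa using hv
    · intro x hx
      have := smul_mem_transvectionVectors hv₀ hGH hg₀ hζ hx
      simpa [smul_smul] using this
  let A : Submodule K V :=
    { transvectionVectors ℓ G with smul_mem' := fun c v hv => hsmul c c.2 v hv }
  have hA : ∀ v, v ∈ Submodule.span K (transvectionVectors ℓ G : Set V) ↔
      v ∈ transvectionVectors ℓ G := by
    intro v
    exact ⟨fun hv => (Submodule.span_le (p := A)).2 (fun _ hw => hw) hv,
      fun hv => Submodule.subset_span hv⟩
  have haA : a ∉ transvectionVectors ℓ G := by
    rintro ⟨_, g, hg, hga⟩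
    have : t = g := LinearEquiv.ext fun v => by rw [hta, hga]
    exact htG (this ▸ hg)
  have hex : ∃ j, j ≠ i₀ ∧ lam j a ≠ 0 := by
    by_contra! hcon
    exact haA ((hA a).1 ((hlam a ha).1 hcon))
  obtain ⟨i₁, f₁, lam₁, hi, h₁, ha₀, ha₁, hlam₁⟩ := h.exists_normalized hv₀ hex
  obtain ⟨x, m₂, lam₂, h₂, hlam₂⟩ := h₁.extend hv₀ hi ha ha₀ ha₁
  have hker₁ : ∀ v, ℓ v = 0 → ((∀ j, j ≠ i₀ → lam₁ j v = 0) ↔ v ∈ transvectionVectors ℓ G) :=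
    fun v hv => by rw [hlam₁, hlam v hv, hA]
  have hinvG : ∀ p, p ∈ invariants G ↔ (∀ b ∈ transvectionVectors ℓ G, shear ℓ b p = p) ∧
      shear ℓ ((ζ - 1) • v₀) p = p :=
    fun p => mem_invariants_iff_shear hv₀ hGH hg₀ hζ hpow hζ0
  have hinvG' : ∀ p, p ∈ invariants G' ↔ p ∈ invariants G ∧ shear ℓ a p = p := by
    intro p
    rw [mem_invariants_iff_le_fixer, hG', Subgroup.closure_le, Set.union_subset_iff,
      Set.singleton_subset_iff, mem_invariants_iff_le_fixer, SetLike.coe_subset_coe,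
      SetLike.mem_coe, mem_fixer_iff_shear hta]
  have hℓsmul : ∀ (c : K) (v : V), ℓ v = 0 → ℓ (c • v) = 0 := fun c v hv => by
    rw [Subfield.smul_def, map_smul, hv, smul_zero]
  have hζ' : IsOfFinOrder (⟨ζ, hζK⟩ : K) :=
    (Function.Injective.isOfFinOrder_iff (f := K.subtype.toMonoidHom) K.subtype.injective).1 hζfin
  have hbasic₁ := h₁.isBasicInvariants hv₀ hζ' (G := G) (by
    intro p
    rw [hinvG]
    refine and_congr ⟨fun hp v hv hv' => hp v ((hker₁ v hv).1 hv'), fun hp v hv =>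
      hp v hv.1 ((hker₁ v hv.1).2 hv)⟩ Iff.rfl)
  have hbasic₂ := h₂.isBasicInvariants hv₀ hζ' (G := G') (by
    intro p
    rw [hinvG', hinvG]
    constructor
    · rintro ⟨⟨h1, h2⟩, h3⟩
      refine ⟨fun v hv hv' => ?_, h2⟩
      obtain ⟨c, hc⟩ := (hlam₂ v).1 hv'
      have hc' := (hker₁ _ (by rw [map_add, hv, hℓsmul c a ha, add_zero])).1 hc
      -- Invariance under `t` and `g₀` spreads to all `K`-multiples of `a`; a vector `v` of `A + K
      -- a` is then reached by composing the shears along `v + c • a ∈ A` and `-c • a`.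
      have h4 : ∀ d ∈ K, shear ℓ (d • a) p = p := by
        refine hKind (fixingScalars ℓ ha p) ?_ ?_
        · change shear ℓ ((1 : F) • a) p = p
          rwa [one_smul]
        · intro y hy
          change shear ℓ ((ζ * y) • a) p = p
          rw [mul_smul]
          exact shear_smul_eigenvalue hv₀ h2 (by rw [map_smul, ha, smul_zero]) hy
      have h5 := shear_shear ℓ (v + c • a) (-c • a) p
      rw [hc'.1, add_zero, one_smul, neg_smul, add_neg_cancel_right, ← neg_smul,
        show shear ℓ (-c • a) p = p from h4 _ (-c).2, h1 _ hc'] at h5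
      exact h5.symm
    · rintro ⟨h1, h2⟩
      refine ⟨⟨fun v hv => h1 v hv.1 ((hlam₂ v).2 ⟨0, ?_⟩), h2⟩, h1 a ha ((hlam₂ a).2 ⟨-1, ?_⟩)⟩
      · rw [zero_smul, add_zero]
        exact (hker₁ v hv.1).2 hv
      · intro j _
        rw [neg_smul, one_smul, add_neg_cancel, map_zero])
  -- The changes at `i₀` and `i₁` commute, so the basic invariants of `G'` are those of `G` with
  -- only the member `i₁` replaced.
  rw [Function.update_of_ne hi.symm, Function.update_comm hi] at hbasic₂
  refine ⟨_, i₁, x, hbasic₁, ?_, hbasic₂, fun j hj => ?_⟩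
  · rw [hbasic₂.invariants_eq]
    exact Algebra.subset_adjoin ⟨i₁, Function.update_self _ _ _⟩
  · rw [hbasic₂.invariants_eq]
    exact Algebra.subset_adjoin ⟨j, Function.update_of_ne hj _ _⟩
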